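/- **Definitions.** The natural sum $\alpha\mathbin{\#}\beta$ of two ordinals is obtained by writing $\alpha$ and $\beta$ in Cantor normal form and adding the (integer) coefficients of equal powers of $\omega$. Let $\zeta$ be an ordinal, $(\alpha_\gamma)_{\gamma<\zeta}$ a sequence of ordinals and $G$ a set of ordinals. The partial natural sums relative to $G$, $S^G_\delta=\sum^G_{\gamma<\delta}\alpha_\gamma$ for $\delta\le\zeta$, are defined by transfinite recursion: $S^G_0=0$; $S^G_{\delta+1}=S^G_\delta\mathbin{\#}\alpha_\delta$ if $\delta\in G$ and $S^G_{\delta+1}=S^G_\delta+\alpha_\delta$ (ordinal sum) if $\delta\notin G$; $S^G_\delta=\sup_{\delta'<\delta}S^G_{\delta'}$ for $\delta$ limit. An ordinal $\beta=\{\beta'\mid\beta'<\beta\}$ is a mixed sum of $(\alpha_i)_{i\in I}$ realized by $(A_i)_{i\in I}$ if the $A_i$ are pairwise disjoint subsets of $\beta$ with $\bigcup_{i\in I}A_i=\beta$ and each $A_i$, with the order induced by $\beta$, has order type $\alpha_i$. The piece $A_i$ is convex in the realization if $\{\beta'<\beta\mid a<\beta'<a'\}\subseteq A_i$ for all $a<a'$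 in $A_i$. **Theorem 4.2.** Suppose that $\zeta$ is an ordinal, $(\alpha_\gamma)_{\gamma<\zeta}$ is a sequence of ordinals and $G\subseteq\zeta$. Put $\beta=\sum^G_{\gamma<\zeta}\alpha_\gamma$. Then $\beta$ is a mixed sum of $(\alpha_\gamma)_{\gamma<\zeta}$. Moreover, $\beta$ can be realized by some $(A_\gamma)_{\gamma<\zeta}$ such that 1. for every $\varepsilon<\zeta$, the set $\Gamma_\varepsilon=\{\gamma<\zeta\mid\gamma>\varepsilon\text{ and } b<a\text{ for some }b\in A_\gamma\text{ and }a\in A_\varepsilon\}$ is finite, and 2. all but finitely many of the $A_\varepsilon$ ($\varepsilon<\zeta$) are convex in the realization. -/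

import Mathlib

universe u v

namespace MixedSums

open Ordinal

/-- The natural (Hessenberg) sum of two ordinals: add the coefficients of the two Cantor normal
forms (base `ω`) exponent by exponent and evaluate the resulting normal form. All coefficients of
a base `ω` normal form are finite, so their ordinal sum is the usual sum of integers. -/
noncomputable def natSum (a b : Ordinal.{u}) : Ordinal.{u} :=
  CNF.eval ω (CNF.coeff ω a + CNF.coeff ω b)

open Classical in
/-- The partial natural sum of `α` relative to the set of ordinals `G`: `partialNatSum G α δ` is
the sum over all `γ < δ`. It is `0` at `0`, at a step `δ + 1` one adds `α δ` by a natural sum if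
`δ ∈ G` and by the ordinal sum if `δ ∉ G`, and at limits one takes the supremum of the previous
values. Only the values `α γ` with `γ < δ` matter. -/
noncomputable def partialNatSum (G : Set Ordinal.{u}) (α : Ordinal.{u} → Ordinal.{u})
    (δ : Ordinal.{u}) : Ordinal.{u} :=
  limitRecOn (motive := fun _ => Ordinal.{u}) δ 0
    (fun δ S => if δ ∈ G then natSum S (α δ) else S + α δ)
    (fun δ _ S => ⨆ δ' : Set.Iio δ, S δ'.1 δ'.2)

theorem partialNatSum_zero (G : Set Ordinal.{u}) (α : Ordinal.{u} → Ordinal.{u}) :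
    partialNatSum G α 0 = 0 :=
  limitRecOn_zero ..

theorem partialNatSum_add_one_of_mem {G : Set Ordinal.{u}} (α : Ordinal.{u} → Ordinal.{u})
    {δ : Ordinal.{u}} (h : δ ∈ G) :
    partialNatSum G α (δ + 1) = natSum (partialNatSum G α δ) (α δ) := by
  rw [partialNatSum, limitRecOn_add_one, if_pos h, partialNatSum]

theorem partialNatSum_add_one_of_notMem {G : Set Ordinal.{u}} (α : Ordinal.{u} → Ordinal.{u})
    {δ : Ordinal.{u}} (h : δ ∉ G) :
    partialNatSum G α (δ + 1) = partialNatSum G α δ + α δ := by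
  rw [partialNatSum, limitRecOn_add_one, if_neg h, partialNatSum]

theorem partialNatSum_limit (G : Set Ordinal.{u}) (α : Ordinal.{u} → Ordinal.{u})
    {δ : Ordinal.{u}} (h : Order.IsSuccLimit δ) :
    partialNatSum G α δ = ⨆ δ' : Set.Iio δ, partialNatSum G α δ' := by
  rw [partialNatSum, limitRecOn_limit _ _ _ _ h]
  rfl

/-- `β` is a mixed sum of `(α i)` realized by `(A i)`: the sets `A i` are pairwise disjoint, their
union is the set `β = {β' | β' < β}`, and each `A i`, with the induced order, has order type
`α i`. -/
structure IsRealization {I : Type v} (β : Ordinal.{u}) (α : I → Ordinal.{u})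
    (A : I → Set Ordinal.{u}) : Prop where
  disjoint : ∀ i j, i ≠ j → Disjoint (A i) (A j)
  iUnion_eq : ⋃ i, A i = Set.Iio β
  type_eq : ∀ i, type (fun x y : A i => x < y) = lift.{u + 1} (α i)

/-- `β` is a mixed sum of the family `(α i)`. -/
def IsMixedSum {I : Type v} (β : Ordinal.{u}) (α : I → Ordinal.{u}) : Prop :=
  ∃ A : I → Set Ordinal.{u}, IsRealization β α A

/-- A piece `S ⊆ β` is convex in `β` if it contains every `β' < β` lying strictly between two of
its elements. -/
def IsConvexPiece (β : Ordinal.{u}) (S : Set Ordinal.{u}) : Prop :=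
  ∀ a ∈ S, ∀ a' ∈ S, a < a' → {β' | β' < β ∧ a < β' ∧ β' < a'} ⊆ S

end MixedSums

namespace MixedSums

open Ordinal Set

/-! A realization is built by induction on the length. The natural sum interleaves two Cantor normal
forms term by term, so the added copy of `α ζ` enters the old ordinal at only finitely many cuts
(`IsMerge.exists_embedding`). Pieces are disjoint, so each cut lies in at most one of them: a
natural step spoils the convexity of finitely many pieces and adds at most one crossing to each
earlier piece. An ordinary step appends an interval and spoils nothing.

Limits are the difficulty, since infinitely many natural steps could spoil infinitely many pieces.
The remedy is `exists_partialNatSum_eq_add_tailSum`: some `δ < ζ` has `S_ζ = S_δ +` the ordinary sum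
of the later terms, so a realization at `δ` is simply extended by intervals. Indeed the tails of the
ordinary sum are nonincreasing in their starting index, hence eventually constant, say `σ`. Then `σ`
absorbs every sum of consecutive terms from there on, so it is zero or additively principal, and
natural steps by terms below a principal `σ` never carry `S_δ` past `S_δ + σ`. -/

/-! ### Natural sums as merges of blocks -/

/-- `IsMerge a b s` says that `s` arises from `a` by repeatedly appending blocks at the right end,
each block being either a new final block of the right summand `b`, or a final block of the left
summand `a` that would be absorbed by the part of `b` built so far. -/
inductive IsMerge : Ordinal.{u} → Ordinal.{u} → Ordinal.{u} → Prop
  | base (a) : IsMerge a 0 a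
  | left {a b s} (z) : IsMerge a b s → z + b = b → IsMerge (a + z) b (s + z)
  | right {a b s} (z) : IsMerge a b s → IsMerge a (b + z) (s + z)

theorem eval_eq_eval_erase_add {f : Ordinal.{u} →₀ Ordinal.{u}} {q : Ordinal.{u}}
    (hq : ∀ e ∈ f.support, q ≤ e) :
    CNF.eval ω f = CNF.eval ω (f.erase q) + ω ^ q * f q := by
  rw [← CNF.eval_single, ← CNF.eval_add, Finsupp.erase_add_single]
  intro e₁ h₁ e₂ h₂
  rw [Finset.mem_singleton.1 (Finsupp.support_single_subset h₂)]
  exact hq _ (Finset.mem_of_mem_erase (by simpa [Finsupp.support_erase] using h₁))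

/-- Induction on the number of terms, peeling off a term of least exponent. On a tie the term of `g`
is last; a term of `f` is peeled only when its exponent is below all those of `g`, and then `g`
absorbs it. -/
theorem isMerge_eval (f g : Ordinal.{u} →₀ Ordinal.{u}) (hf : ∀ e, f e < ω) :
    IsMerge (CNF.eval ω f) (CNF.eval ω g) (CNF.eval ω (f + g)) := by
  induction hn : f.support.card + g.support.card using Nat.strong_induction_on generalizing f g with
  | _ n ih =>
  obtain rfl | hg := eq_or_ne g 0
  · simpa using IsMerge.base _
  have hg' : g.support.Nonempty := Finsupp.support_nonempty_iff.2 hg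
  set q := g.support.min' hg' with hq
  have hqg : q ∈ g.support := Finset.min'_mem _ _
  have hqm : ∀ e ∈ g.support, q ≤ e := fun e he => Finset.min'_le _ _ he
  by_cases hfq : ∀ e ∈ f.support, q ≤ e
  · have hfg : CNF.eval ω (f + g) = CNF.eval ω (f + g.erase q) + ω ^ q * g q := by
      rw [← CNF.eval_single, ← CNF.eval_add, add_assoc, Finsupp.erase_add_single]
      intro e₁ h₁ e₂ h₂
      rw [Finset.mem_singleton.1 (Finsupp.support_single_subset h₂)]
      rcases Finset.mem_union.1 (Finsupp.support_add h₁) with h | h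
      · exact hfq _ h
      · exact hqm _ (Finset.mem_of_mem_erase (by simpa [Finsupp.support_erase] using h))
    rw [hfg, eval_eq_eval_erase_add hqm]
    refine .right _ (ih _ ?_ f _ hf rfl)
    have := Finset.card_erase_lt_of_mem hqg
    rw [Finsupp.support_erase]
    omega
  · push Not at hfq
    obtain ⟨e, he, heq⟩ := hfq
    have hf' : f.support.Nonempty := ⟨e, he⟩
    set p := f.support.min' hf' with hp
    have hpf : p ∈ f.support := Finset.min'_mem _ _
    have hpm : ∀ e ∈ f.support, p ≤ e := fun e he => Finset.min'_le _ _ he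
    have hpq : p < q := (hpm e he).trans_lt heq
    have hgp : g p = 0 := by
      by_contra h
      exact (hqm p (Finsupp.mem_support_iff.2 h)).not_gt hpq
    have hadd : f + g = (f.erase p + g) + Finsupp.single p (f p) := by
      ext x
      obtain rfl | hx := eq_or_ne x p
      · simp [hgp]
      · simp [Finsupp.erase_ne hx, Finsupp.single_eq_of_ne hx]
    have hfg : CNF.eval ω (f + g) = CNF.eval ω (f.erase p + g) + ω ^ p * f p := by
      rw [← CNF.eval_single, ← CNF.eval_add, ← hadd]
      intro e₁ h₁ e₂ h₂
      rw [Finset.mem_singleton.1 (Finsupp.support_single_subset h₂)]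
      rcases Finset.mem_union.1 (Finsupp.support_add h₁) with h | h
      · exact hpm _ (Finset.mem_of_mem_erase (by simpa [Finsupp.support_erase] using h))
      · exact hpq.le.trans (hqm _ h)
    rw [hfg, eval_eq_eval_erase_add hpm]
    refine .left _ (ih _ ?_ _ g ?_ rfl) ?_
    · have := Finset.card_erase_lt_of_mem hpf
      rw [Finsupp.support_erase]
      omega
    · intro x
      obtain rfl | hx := eq_or_ne x p
      · simp [omega0_pos]
      · simpa [Finsupp.erase_ne hx] using hf x
    · apply add_of_omega0_opow_le (b := q)
      · exact opow_mul_lt_opow (hf p) hpq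
      · rw [eval_eq_eval_erase_add hqm]
        refine le_trans ?_ (le_add_self)
        exact le_mul_left _ (pos_iff_ne_zero.2 (Finsupp.mem_support_iff.1 hqg))

theorem coeff_omega0_lt (a e : Ordinal.{u}) : CNF.coeff ω a e < ω := by
  by_cases h : e ∈ (CNF ω a).map Prod.fst
  · obtain ⟨⟨e, c⟩, hc, rfl⟩ := List.mem_map.1 h
    rw [CNF.coeff_of_mem_CNF hc]
    exact CNF.snd_lt one_lt_omega0 hc
  · rw [CNF.coeff_of_notMem_CNF h]
    exact omega0_pos

theorem isMerge_natSum (a b : Ordinal.{u}) : IsMerge a b (natSum a b) := by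
  simpa [natSum, CNF.eval_coeff] using
    isMerge_eval (CNF.coeff ω a) (CNF.coeff ω b) (coeff_omega0_lt a)

theorem IsMerge.add_le {a b s : Ordinal.{u}} (h : IsMerge a b s) : a + b ≤ s := by
  induction h with
  | base a => simp
  | left z _ hz ih =>
    rw [add_assoc, hz]
    exact ih.trans le_self_add
  | right z _ ih =>
    rw [← add_assoc]
    gcongr

/-- Every appended block is at most `b`, hence below `σ`; left blocks are so because `z ≤ z + b =
b`. -/
theorem IsMerge.lt_add {a b s ρ σ : Ordinal.{u}} (h : IsMerge a b s)
    (hσ : IsPrincipal (· + ·) σ) (ha : a < ρ + σ) (hb : b < σ) : s < ρ + σ := by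
  have key : ∀ {x z : Ordinal.{u}}, x < ρ + σ → z < σ → x + z < ρ + σ := by
    intro x z hx hz
    obtain ⟨y, hy, hxy⟩ := (lt_add_iff (pos_of_gt hz).ne').1 hx
    calc x + z ≤ ρ + (y + z) := by rw [← add_assoc]; gcongr
      _ < ρ + σ := by gcongr; exact hσ hy hz
  induction h with
  | base a => exact ha
  | left z _ hz ih =>
    exact key (ih (le_self_add.trans_lt ha) hb) ((le_self_add.trans_eq hz).trans_lt hb)
  | right z _ ih => exact key (ih ha (le_self_add.trans_lt hb)) (le_add_self.trans_lt hb)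

theorem IsMerge.eq_of_right_eq_zero {a b s : Ordinal.{u}} (h : IsMerge a b s) (hb : b = 0) :
    s = a := by
  induction h with
  | base a => rfl
  | left z _ hz ih => rw [ih hb]
  | right z _ ih =>
    rw [ih (nonpos_iff_eq_zero.1 (le_self_add.trans_eq hb)),
      nonpos_iff_eq_zero.1 (le_add_self.trans_eq hb), add_zero]

/-! ### Order types of sets of ordinals -/

/-- `S` is the image of an order embedding of the ordinal `a`. -/
def HasOrderType (S : Set Ordinal.{u}) (a : Ordinal.{u}) : Prop :=
  ∃ f : Ordinal.{u} → Ordinal.{u}, StrictMonoOn f (Iio a) ∧ f '' Iio a = S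

theorem HasOrderType.type_eq {S : Set Ordinal.{u}} {a : Ordinal.{u}} (h : HasOrderType S a) :
    type (fun x y : S => x < y) = lift.{u + 1} a := by
  obtain ⟨f, hf, rfl⟩ := h
  rw [← type_lt_Iio]
  exact (Ordinal.type_eq.2 ⟨(hf.orderIso f (Iio a)).toRelIsoLT⟩).symm

theorem HasOrderType.image {S : Set Ordinal.{u}} {a b : Ordinal.{u}} (h : HasOrderType S a)
    {f : Ordinal.{u} → Ordinal.{u}} (hf : StrictMonoOn f (Iio b)) (hS : S ⊆ Iio b) :
    HasOrderType (f '' S) a := by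
  obtain ⟨g, hg, rfl⟩ := h
  exact ⟨f ∘ g, hf.comp hg fun x hx => hS (mem_image_of_mem g hx), image_comp f g _⟩

theorem add_image_Iio (s z : Ordinal.{u}) : (s + ·) '' Iio z = Ico s (s + z) := by
  ext y
  constructor
  · rintro ⟨x, hx, rfl⟩
    exact ⟨le_self_add, by simpa using hx⟩
  · rintro ⟨h₁, h₂⟩
    refine ⟨y - s, ?_, Ordinal.add_sub_cancel_of_le h₁⟩
    rw [← Ordinal.add_sub_cancel_of_le h₁] at h₂
    simpa using h₂

theorem hasOrderType_Ico_add (s z : Ordinal.{u}) : HasOrderType (Ico s (s + z)) z :=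
  ⟨(s + ·), fun _ _ _ _ h => by simpa using h, add_image_Iio s z⟩

open Classical in
/-- Extend `f` from `Iio a` by the order isomorphism of `[a, ∞)` with `[s, ∞)`. -/
noncomputable def extend (f : Ordinal.{u} → Ordinal.{u}) (a s x : Ordinal.{u}) : Ordinal.{u} :=
  if x < a then f x else s + (x - a)

theorem extend_of_lt (f : Ordinal.{u} → Ordinal.{u}) {a x : Ordinal.{u}} (s : Ordinal.{u})
    (h : x < a) : extend f a s x = f x := if_pos h

theorem extend_add (f : Ordinal.{u} → Ordinal.{u}) (a s x : Ordinal.{u}) :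
    extend f a s (a + x) = s + x := by
  rw [extend, if_neg le_self_add.not_gt, Ordinal.add_sub_cancel]

theorem lt_or_exists_add {a z x : Ordinal.{u}} (h : x < a + z) : x < a ∨ ∃ y < z, x = a + y := by
  refine (lt_or_ge x a).imp_right fun hx => ⟨x - a, ?_, (Ordinal.add_sub_cancel_of_le hx).symm⟩
  rw [← Ordinal.add_sub_cancel_of_le hx] at h
  simpa using h

theorem strictMonoOn_extend {f : Ordinal.{u} → Ordinal.{u}} {a s : Ordinal.{u}}
    (hf : StrictMonoOn f (Iio a)) (hs : ∀ x < a, f x < s) (z : Ordinal.{u}) :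
    StrictMonoOn (extend f a s) (Iio (a + z)) := by
  intro x hx y hy hxy
  obtain hy | ⟨y, hy, rfl⟩ := lt_or_exists_add hy
  · rw [extend_of_lt f s hy, extend_of_lt f s (hxy.trans hy)]
    exact hf (hxy.trans hy) hy hxy
  · obtain hx | ⟨x, hx, rfl⟩ := lt_or_exists_add hx
    · rw [extend_of_lt f s hx, extend_add]
      exact (hs x hx).trans_le le_self_add
    · rw [extend_add, extend_add]
      simpa using hxy

theorem extend_image (f : Ordinal.{u} → Ordinal.{u}) (a s z : Ordinal.{u}) :
    extend f a s '' Iio (a + z) = f '' Iio a ∪ Ico s (s + z) := by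
  rw [← add_image_Iio]
  ext w
  constructor
  · rintro ⟨x, hx, rfl⟩
    obtain hx | ⟨y, hy, rfl⟩ := lt_or_exists_add hx
    · exact .inl ⟨x, hx, (extend_of_lt f s hx).symm⟩
    · exact .inr ⟨y, hy, (extend_add f a s y).symm⟩
  · rintro (⟨x, hx, rfl⟩ | ⟨x, hx, rfl⟩)
    · exact ⟨x, mem_Iio.2 (hx.trans_le le_self_add), extend_of_lt f s hx⟩
    · exact ⟨a + x, mem_Iio.2 (by gcongr; exact hx), extend_add f a s x⟩

theorem Iio_union_Ico_add (s z : Ordinal.{u}) : Iio s ∪ Ico s (s + z) = Iio (s + z) :=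
  Iio_union_Ico_eq_Iio le_self_add

theorem disjoint_Ico_of_subset_Iio {X : Set Ordinal.{u}} {s t : Ordinal.{u}} (h : X ⊆ Iio s) :
    Disjoint X (Ico s t) :=
  disjoint_left.2 fun _ hx hy => hy.1.not_gt (h hx)

/-- A merge of `a` and `b` splits into a copy `f '' Iio a` of `a` and a copy `Y` of `b`, where `Y`
enters the copy of `a` at finitely many cuts only. -/
theorem IsMerge.exists_embedding {a b s : Ordinal.{u}} (h : IsMerge a b s) :
    ∃ (f : Ordinal.{u} → Ordinal.{u}) (Y : Set Ordinal.{u}) (C : Set Ordinal.{u}),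
      StrictMonoOn f (Iio a) ∧ HasOrderType Y b ∧ Disjoint (f '' Iio a) Y ∧
      f '' Iio a ∪ Y = Iio s ∧ C.Finite ∧
      ∀ x < a, ∀ x' < a, ∀ y ∈ Y, f x < y → y < f x' → ∃ c ∈ C, x < c ∧ c ≤ x' := by
  induction h with
  | base a =>
    exact ⟨id, ∅, ∅, strictMono_id.strictMonoOn _, ⟨id, strictMono_id.strictMonoOn _, by simp⟩,
      by simp, by simp, finite_empty, by simp⟩
  | @left a b s z h hz ih =>
    obtain ⟨f, Y, C, hf, hY, hd, hu, hC, hcut⟩ := ih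
    have hfs : f '' Iio a ⊆ Iio s := hu ▸ subset_union_left
    have hYs : Y ⊆ Iio s := hu ▸ subset_union_right
    have hlt : ∀ x < a, f x < s := fun x hx => hfs (mem_image_of_mem f hx)
    -- The new block follows all of `Y`, so the only possible new cut is at its first position, `a`.
    refine ⟨extend f a s, Y, insert a C, strictMonoOn_extend hf hlt z, hY, ?_, ?_, hC.insert a, ?_⟩
    · rw [extend_image]
      exact hd.union_left (disjoint_Ico_of_subset_Iio hYs).symm
    · rw [extend_image, union_right_comm, hu, Iio_union_Ico_add]
    · intro x hx x' hx' y hy h₁ h₂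
      have hxa : x < a := by
        obtain hx | ⟨x, hx, rfl⟩ := lt_or_exists_add hx
        · exact hx
        · rw [extend_add] at h₁
          exact absurd (h₁.trans (hYs hy)) le_self_add.not_gt
      obtain hx' | ⟨x', hx', rfl⟩ := lt_or_exists_add hx'
      · rw [extend_of_lt f s hxa] at h₁
        rw [extend_of_lt f s hx'] at h₂
        obtain ⟨c, hc, h⟩ := hcut x hxa x' hx' y hy h₁ h₂
        exact ⟨c, .inr hc, h⟩
      · exact ⟨a, .inl rfl, hxa, le_self_add⟩
  | @right a b s z h ih =>
    obtain ⟨f, Y, C, hf, ⟨g, hg, rfl⟩, hd, hu, hC, hcut⟩ := ih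
    have hfs : f '' Iio a ⊆ Iio s := hu ▸ subset_union_left
    have hgs : g '' Iio b ⊆ Iio s := hu ▸ subset_union_right
    -- The new block lies above the whole copy of `a` and makes no new cut.
    refine ⟨f, extend g b s '' Iio (b + z), C, hf,
      ⟨_, strictMonoOn_extend hg (fun x hx => hgs (mem_image_of_mem g hx)) z, rfl⟩, ?_, ?_, hC, ?_⟩
    · rw [extend_image]
      exact hd.union_right (disjoint_Ico_of_subset_Iio hfs)
    · rw [extend_image, ← union_assoc, hu, Iio_union_Ico_add]
    · rw [extend_image]
      rintro x hx x' hx' y (hy | hy) h₁ h₂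
      · exact hcut x hx x' hx' y hy h₁ h₂
      · exact absurd (h₂.trans (hfs (mem_image_of_mem f hx'))) hy.1.not_gt

/-! ### Partial sums -/

section PartialSums

variable (G : Set Ordinal.{u}) (α : Ordinal.{u} → Ordinal.{u})

theorem lt_partialNatSum_limit {δ x : Ordinal.{u}} (h : Order.IsSuccLimit δ) :
    x < partialNatSum G α δ ↔ ∃ γ < δ, x < partialNatSum G α γ := by
  rw [partialNatSum_limit G α h, Ordinal.lt_iSup_iff]
  simp

theorem partialNatSum_add_le_add_one (δ : Ordinal.{u}) :
    partialNatSum G α δ + α δ ≤ partialNatSum G α (δ + 1) := by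
  by_cases h : δ ∈ G
  · rw [partialNatSum_add_one_of_mem α h]
    exact (isMerge_natSum _ _).add_le
  · rw [partialNatSum_add_one_of_notMem α h]

theorem partialNatSum_add_one_lt {δ ρ σ : Ordinal.{u}} (hσ : IsPrincipal (· + ·) σ)
    (h : partialNatSum G α δ < ρ + σ) (hα : α δ < σ) : partialNatSum G α (δ + 1) < ρ + σ := by
  refine (?_ : partialNatSum G α (δ + 1) ≤ natSum (partialNatSum G α δ) (α δ)).trans_lt
    ((isMerge_natSum _ _).lt_add hσ h hα)
  by_cases h : δ ∈ G
  · rw [partialNatSum_add_one_of_mem α h]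
  · rw [partialNatSum_add_one_of_notMem α h]
    exact (isMerge_natSum _ _).add_le

theorem partialNatSum_add_one_of_eq_zero {δ : Ordinal.{u}} (hα : α δ = 0) :
    partialNatSum G α (δ + 1) = partialNatSum G α δ := by
  by_cases h : δ ∈ G
  · rw [partialNatSum_add_one_of_mem α h]
    exact (isMerge_natSum _ _).eq_of_right_eq_zero hα
  · rw [partialNatSum_add_one_of_notMem α h, hα, add_zero]

theorem partialNatSum_mono : Monotone (partialNatSum G α) := by
  intro γ δ h
  induction δ using limitRecOn with
  | zero => rw [nonpos_iff_eq_zero.1 h]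
  | add_one δ ih =>
    obtain rfl | h := h.eq_or_lt
    · rfl
    · exact (ih (Order.lt_add_one_iff.1 h)).trans
        (le_self_add.trans (partialNatSum_add_le_add_one G α δ))
  | limit δ hδ ih =>
    obtain rfl | h := h.eq_or_lt
    · rfl
    · exact le_of_forall_lt fun x hx => (lt_partialNatSum_limit G α hδ).2 ⟨γ, h, hx⟩

/-- The ordinary sum of the `α γ` with `ε ≤ γ < δ`. -/
noncomputable def tailSum (ε δ : Ordinal.{u}) : Ordinal.{u} :=
  partialNatSum ∅ α δ - partialNatSum ∅ α ε

theorem partialNatSum_empty_add_tailSum {ε δ : Ordinal.{u}} (h : ε ≤ δ) :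
    partialNatSum ∅ α ε + tailSum α ε δ = partialNatSum ∅ α δ :=
  Ordinal.add_sub_cancel_of_le (partialNatSum_mono ∅ α h)

theorem tailSum_mono (ε : Ordinal.{u}) : Monotone (tailSum α ε) := fun _ _ h =>
  Ordinal.sub_le.2 ((partialNatSum_mono ∅ α h).trans (Ordinal.le_add_sub _ _))

theorem tailSum_self (δ : Ordinal.{u}) : tailSum α δ δ = 0 := Ordinal.sub_self _

theorem tailSum_add_tailSum {ε γ δ : Ordinal.{u}} (h₁ : ε ≤ γ) (h₂ : γ ≤ δ) :
    tailSum α ε γ + tailSum α γ δ = tailSum α ε δ := by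
  rw [← add_right_inj (partialNatSum ∅ α ε), ← add_assoc, partialNatSum_empty_add_tailSum α h₁,
    partialNatSum_empty_add_tailSum α h₂, partialNatSum_empty_add_tailSum α (h₁.trans h₂)]

theorem tailSum_self_add_one (δ : Ordinal.{u}) : tailSum α δ (δ + 1) = α δ := by
  rw [tailSum, partialNatSum_add_one_of_notMem α (notMem_empty δ), Ordinal.add_sub_cancel]

theorem tailSum_add_one {ε δ : Ordinal.{u}} (h : ε ≤ δ) :
    tailSum α ε (δ + 1) = tailSum α ε δ + α δ := by
  rw [← tailSum_add_tailSum α h le_self_add, tailSum_self_add_one]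

theorem lt_tailSum_limit {ε δ x : Ordinal.{u}} (hδ : Order.IsSuccLimit δ)
    (hx : x < tailSum α ε δ) : ∃ γ < δ, x < tailSum α ε γ := by
  simpa only [tailSum, Ordinal.lt_sub, lt_partialNatSum_limit ∅ α hδ] using hx

theorem add_tailSum_le {ε δ : Ordinal.{u}} (h : ε ≤ δ) :
    partialNatSum G α ε + tailSum α ε δ ≤ partialNatSum G α δ := by
  induction δ using limitRecOn with
  | zero => rw [nonpos_iff_eq_zero.1 h, tailSum_self, add_zero]
  | add_one δ ih =>
    obtain rfl | h := h.eq_or_lt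
    · rw [tailSum_self, add_zero]
    · have h := Order.lt_add_one_iff.1 h
      rw [tailSum_add_one α h, ← add_assoc]
      exact (add_le_add_left (ih h) _).trans (partialNatSum_add_le_add_one G α δ)
  | limit δ hδ ih =>
    obtain rfl | h := h.eq_or_lt
    · rw [tailSum_self, add_zero]
    · refine le_of_forall_lt fun x hx => (lt_partialNatSum_limit G α hδ).2 ?_
      obtain hx | ⟨y, hy, rfl⟩ := lt_or_exists_add hx
      · exact ⟨ε, h, hx⟩
      · obtain ⟨γ, hγ, hy⟩ := lt_tailSum_limit α hδ hy
        refine ⟨max ε γ, max_lt h hγ, lt_of_lt_of_le ?_ (ih _ (max_lt h hγ) (le_max_left _ _))⟩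
        gcongr
        exact hy.trans_le (tailSum_mono α _ (le_max_right _ _))

/-- Natural sums gain nothing over ordinary sums in the long run: at a limit stage, all steps from
some point on may be replaced by ordinary ones. -/
theorem exists_partialNatSum_eq_add_tailSum {ζ : Ordinal.{u}} (hζ : Order.IsSuccLimit ζ) :
    ∃ δ < ζ, ∀ ε, δ ≤ ε → ε < ζ →
      partialNatSum G α ζ = partialNatSum G α ε + tailSum α ε ζ := by
  induction ζ using WellFoundedLT.induction with
  | _ ζ IH =>
  -- A tail of least value; later tails cannot be larger, so all equal it.
  obtain ⟨δ, hδ, hmin⟩ : ∃ δ < ζ, ∀ ε < ζ, tailSum α δ ζ ≤ tailSum α ε ζ := by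
    have hne : ((tailSum α · ζ) '' Iio ζ).Nonempty := ⟨_, 0, hζ.bot_lt, rfl⟩
    obtain ⟨δ, hδ, h⟩ := csInf_mem hne
    exact ⟨δ, hδ, fun ε hε => h.trans_le (csInf_le' (mem_image_of_mem _ hε))⟩
  set σ := tailSum α δ ζ with hσ
  have hconst : ∀ ε, δ ≤ ε → ε < ζ → tailSum α ε ζ = σ := by
    intro ε h₁ h₂
    refine (hmin ε h₂).antisymm' ?_
    rw [hσ, ← tailSum_add_tailSum α h₁ h₂.le]
    exact le_add_self
  have habs : ∀ ε γ, δ ≤ ε → ε ≤ γ → γ < ζ → tailSum α ε γ + σ = σ := by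
    intro ε γ h₁ h₂ h₃
    have := tailSum_add_tailSum α h₂ h₃.le
    rwa [hconst γ (h₁.trans h₂) h₃, hconst ε h₁ (h₂.trans_lt h₃)] at this
  refine ⟨δ, hδ, fun ε hδε hεζ => (add_tailSum_le G α hεζ.le).antisymm' ?_⟩
  rw [hconst ε hδε hεζ]
  -- If `σ = 0`, all terms from `δ` on vanish and the partial sums are constant.
  obtain h0 | h0 := eq_or_ne σ 0
  · have key : ∀ γ, ε ≤ γ → γ < ζ → partialNatSum G α γ ≤ partialNatSum G α ε := by
      intro γ h₁ h₂
      induction γ using limitRecOn with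
      | zero => rw [nonpos_iff_eq_zero.1 h₁]
      | add_one γ ih =>
        obtain rfl | h₁ := h₁.eq_or_lt
        · rfl
        · have h₁ := Order.lt_add_one_iff.1 h₁
          have hα := habs γ (γ + 1) (hδε.trans h₁) le_self_add h₂
          rw [h0, add_zero, tailSum_self_add_one] at hα
          rw [partialNatSum_add_one_of_eq_zero G α hα]
          exact ih h₁ ((Order.lt_succ γ).trans h₂)
      | limit γ hγ ih =>
        refine le_of_forall_lt fun x hx => ?_
        obtain ⟨γ', h, hx⟩ := (lt_partialNatSum_limit G α hγ).1 hx
        obtain h' | h' := le_total ε γ'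
        · exact hx.trans_le (ih γ' h h' (h.trans h₂))
        · exact hx.trans_le (partialNatSum_mono G α h')
    rw [h0, add_zero]
    refine le_of_forall_lt fun x hx => ?_
    obtain ⟨γ, h, hx⟩ := (lt_partialNatSum_limit G α hζ).1 hx
    obtain h' | h' := le_total ε γ
    · exact hx.trans_le (key γ h' h)
    · exact hx.trans_le (partialNatSum_mono G α h')
  · have hpos : 0 < σ := pos_iff_ne_zero.2 h0
    have hlt : ∀ ε γ, δ ≤ ε → ε ≤ γ → γ < ζ → tailSum α ε γ < σ := by
      intro ε γ h₁ h₂ h₃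
      calc tailSum α ε γ = tailSum α ε γ + 0 := (add_zero _).symm
        _ < tailSum α ε γ + σ := by gcongr
        _ = σ := habs ε γ h₁ h₂ h₃
    have hprin : IsPrincipal (· + ·) σ := by
      rw [isPrincipal_add_iff_add_left_eq_self]
      intro x hx
      obtain ⟨γ, hγ, hxγ⟩ := lt_tailSum_limit α hζ hx
      have hγ' : max δ γ < ζ := max_lt hδ hγ
      have hle : x ≤ tailSum α δ (max δ γ) :=
        hxγ.le.trans (tailSum_mono α _ (le_max_right _ _))
      exact ((add_le_add_left hle σ).trans_eq
        (habs δ _ le_rfl (le_max_left _ _) hγ')).antisymm le_add_self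
    have key : ∀ γ, ε ≤ γ → γ < ζ → partialNatSum G α γ < partialNatSum G α ε + σ := by
      intro γ h₁ h₂
      induction γ using limitRecOn with
      | zero =>
        rw [nonpos_iff_eq_zero.1 h₁]
        exact lt_add_of_pos_right _ hpos
      | add_one γ ih =>
        obtain rfl | h₁ := h₁.eq_or_lt
        · exact lt_add_of_pos_right _ hpos
        · have h₁ := Order.lt_add_one_iff.1 h₁
          refine partialNatSum_add_one_lt G α hprin (ih h₁ ((Order.lt_succ γ).trans h₂)) ?_
          rw [← tailSum_self_add_one α γ]
          exact hlt _ _ (hδε.trans h₁) le_self_add h₂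
      | limit γ hγ ih =>
        obtain rfl | h₁ := h₁.eq_or_lt
        · exact lt_add_of_pos_right _ hpos
        -- A supremum of values below the bound might reach it; the induction hypothesis at `γ`
        -- instead gives an earlier value plus an ordinary tail below `σ`.
        · obtain ⟨δ', hδ', h⟩ := IH γ h₂ hγ
          have hm : max ε δ' < γ := max_lt h₁ hδ'
          rw [h _ (le_max_right ε δ') hm]
          obtain ⟨y, hy, hxy⟩ := (lt_add_iff h0).1 (ih _ hm (le_max_left _ _) (hm.trans h₂))
          calc _ ≤ partialNatSum G α ε + (y + tailSum α (max ε δ') γ) := by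
                rw [← add_assoc]; gcongr
            _ < _ := by
                gcongr
                exact hprin hy (hlt _ _ (hδε.trans (le_max_left _ _)) hm.le h₂)
    refine le_of_forall_lt fun x hx => ?_
    obtain ⟨γ, h, hx⟩ := (lt_partialNatSum_limit G α hζ).1 hx
    obtain h' | h' := le_total ε γ
    · exact hx.trans (key γ h' h)
    · exact (hx.trans_le (partialNatSum_mono G α h')).trans_le le_self_add

end PartialSums

/-! ### Realizations with few crossings -/

/-- `A` realizes `β` as a mixed sum of the `α γ` with `γ < ζ`, each piece is crossed by finitely
many later pieces, and almost all pieces are convex. -/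
structure IsTameRealization (ζ β : Ordinal.{u}) (α : Ordinal.{u} → Ordinal.{u})
    (A : Ordinal.{u} → Set Ordinal.{u}) : Prop where
  disjoint : ∀ γ < ζ, ∀ γ' < ζ, γ ≠ γ' → Disjoint (A γ) (A γ')
  mem_iff : ∀ x, x < β ↔ ∃ γ < ζ, x ∈ A γ
  hasOrderType : ∀ γ < ζ, HasOrderType (A γ) (α γ)
  crossings : ∀ ε < ζ, {γ | γ < ζ ∧ ε < γ ∧ ∃ b ∈ A γ, ∃ a ∈ A ε, b < a}.Finite
  convex : {ε | ε < ζ ∧ ¬ (A ε).OrdConnected}.Finite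

namespace IsTameRealization

variable {ζ β : Ordinal.{u}} {α : Ordinal.{u} → Ordinal.{u}} {A : Ordinal.{u} → Set Ordinal.{u}}

theorem subset (h : IsTameRealization ζ β α A) {γ : Ordinal.{u}} (hγ : γ < ζ) : A γ ⊆ Iio β :=
  fun x hx => (h.mem_iff x).2 ⟨γ, hγ, hx⟩

theorem isRealization (h : IsTameRealization ζ β α A) :
    IsRealization β (fun γ : Iio ζ => α γ) (fun γ : Iio ζ => A γ) where
  disjoint i j hij := h.disjoint i i.2 j j.2 fun e => hij (Subtype.ext e)
  iUnion_eq := by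
    ext x
    simp [h.mem_iff x]
  type_eq i := (h.hasOrderType i i.2).type_eq

open Classical in
/-- Pieces can be appended to a realization one after the other, forming an ordinary sum. -/
theorem append {δ : Ordinal.{u}} (hδ : δ ≤ ζ) {T : Ordinal.{u} → Ordinal.{u}}
    (h : IsTameRealization δ (T δ) α A) (hT : Monotone T)
    (hsucc : ∀ γ, δ ≤ γ → γ < ζ → T (γ + 1) = T γ + α γ)
    (hlim : ∀ γ ≤ ζ, Order.IsSuccLimit γ → δ < γ → ∀ x < T γ, ∃ γ' < γ, x < T γ') :
    IsTameRealization ζ (T ζ) α fun γ => if γ < δ then A γ else Ico (T γ) (T (γ + 1)) := by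
  have hmono : ∀ {γ γ'}, γ < γ' → T (γ + 1) ≤ T γ' := fun h => hT (Order.add_one_le_of_lt h)
  have hcross : ∀ {ε γ}, ε < γ → ¬ γ < δ →
      ∀ b ∈ Ico (T γ) (T (γ + 1)),
      ∀ a ∈ (if ε < δ then A ε else Ico (T ε) (T (ε + 1))), a < b := by
    intro ε γ hεγ hγ b hb a ha
    split_ifs at ha with hε
    · exact ((h.subset hε ha).trans_le (hT (not_lt.1 hγ))).trans_le hb.1
    · exact (ha.2.trans_le (hmono hεγ)).trans_le hb.1
  have hdisj : ∀ γ < ζ, ∀ γ' < ζ, γ < γ' →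
      Disjoint (if γ < δ then A γ else Ico (T γ) (T (γ + 1)))
        (if γ' < δ then A γ' else Ico (T γ') (T (γ' + 1))) := by
    intro γ _ γ' _ hlt
    by_cases hγ' : γ' < δ
    · simpa only [if_pos hγ', if_pos (hlt.trans hγ')] using
        h.disjoint γ (hlt.trans hγ') γ' hγ' hlt.ne
    · rw [if_neg hγ', disjoint_left]
      exact fun x hx hx' => (hcross hlt hγ' x hx' x hx).false
  constructor
  · intro γ hγ γ' hγ' hne
    obtain hlt | hlt := hne.lt_or_gt
    · exact hdisj γ hγ γ' hγ' hlt
    · exact (hdisj γ' hγ' γ hγ hlt).symm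
  · intro x
    constructor
    · intro hx
      obtain hxδ | hxδ := lt_or_ge x (T δ)
      · obtain ⟨γ, hγ, hxγ⟩ := (h.mem_iff x).1 hxδ
        exact ⟨γ, hγ.trans_le hδ, by rwa [if_pos hγ]⟩
      -- The least `γ` with `x < T γ` is not a limit, by `hlim`; its predecessor indexes the
      -- interval containing `x`.
      · obtain ⟨γ, hγ, hmin⟩ := WellFounded.has_min (wellFounded_lt (α := Ordinal.{u}))
          {γ | x < T γ} ⟨ζ, hx⟩
        have hδγ : δ < γ := lt_of_not_ge fun hle => hxδ.not_gt (lt_of_lt_of_le hγ (hT hle))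
        have hγζ : γ ≤ ζ := not_lt.1 fun hlt => hmin ζ hx hlt
        obtain rfl | ⟨γ', rfl⟩ | hl := zero_or_succ_or_isSuccLimit γ
        · exact absurd hδγ not_lt_zero
        · have hγ' : γ' < γ' + 1 := Order.lt_succ γ'
          refine ⟨γ', hγ'.trans_le hγζ, ?_⟩
          rw [if_neg (Order.lt_add_one_iff.1 hδγ).not_gt]
          exact ⟨not_lt.1 fun hlt => hmin γ' hlt hγ', hγ⟩
        · obtain ⟨γ', hlt, hx'⟩ := hlim γ hγζ hl hδγ x hγ
          exact absurd hlt (hmin γ' hx')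
    · rintro ⟨γ, hγ, hx⟩
      split_ifs at hx with hγδ
      · exact (h.subset hγδ hx).trans_le (hT hδ)
      · exact hx.2.trans_le (hmono hγ)
  · intro γ hγ
    by_cases hγδ : γ < δ
    · simpa only [if_pos hγδ] using h.hasOrderType γ hγδ
    · rw [if_neg hγδ, hsucc γ (not_lt.1 hγδ) hγ]
      exact hasOrderType_Ico_add _ _
  · intro ε hε
    by_cases hεδ : ε < δ
    · refine (h.crossings ε hεδ).subset ?_
      rintro γ ⟨hγ, hεγ, b, hb, a, ha, hba⟩
      by_cases hγδ : γ < δ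
      · rw [if_pos hγδ] at hb
        rw [if_pos hεδ] at ha
        exact ⟨hγδ, hεγ, b, hb, a, ha, hba⟩
      · rw [if_neg hγδ] at hb
        exact absurd hba (hcross hεγ hγδ b hb a ha).not_gt
    · convert finite_empty
      refine eq_empty_of_forall_notMem ?_
      rintro γ ⟨hγ, hεγ, b, hb, a, ha, hba⟩
      have hγδ : ¬ γ < δ := fun h => hεδ (hεγ.trans h)
      rw [if_neg hγδ] at hb
      exact absurd hba (hcross hεγ hγδ b hb a ha).not_gt
  · refine h.convex.subset ?_
    rintro ε ⟨hε, hc⟩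
    by_cases hεδ : ε < δ
    · exact ⟨hεδ, by rwa [if_pos hεδ] at hc⟩
    · rw [if_neg hεδ] at hc
      exact absurd ordConnected_Ico hc

open Classical in
/-- One more piece can be merged into a realization, forming a natural sum. -/
theorem exists_natSum (h : IsTameRealization ζ β α A) :
    ∃ A', IsTameRealization (ζ + 1) (natSum β (α ζ)) α A' := by
  obtain ⟨f, Y, C, hf, hY, hd, hu, hC, hcut⟩ := (isMerge_natSum β (α ζ)).exists_embedding
  have hdY : ∀ γ < ζ, Disjoint (f '' A γ) Y := fun γ hγ =>
    hd.mono_left (image_mono (h.subset hγ))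
  have hpos : ∀ {γ}, γ < ζ → (if γ < ζ then f '' A γ else Y) = f '' A γ := fun h => if_pos h
  have hneg : (if ζ < ζ then f '' A ζ else Y) = Y := if_neg (lt_irrefl ζ)
  have hlt : ∀ {γ}, γ < ζ + 1 → γ < ζ ∨ γ = ζ := fun h =>
    (Order.lt_add_one_iff.1 h).lt_or_eq
  refine ⟨fun γ => if γ < ζ then f '' A γ else Y, ?_, ?_, ?_, ?_, ?_⟩
  · intro γ hγ γ' hγ' hne
    obtain hγ | rfl := hlt hγ <;> obtain hγ' | rfl := hlt hγ'
    · rw [hpos hγ, hpos hγ']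
      rw [disjoint_iff_inter_eq_empty, ← hf.injOn.image_inter (h.subset hγ) (h.subset hγ'),
        (h.disjoint γ hγ γ' hγ' hne).inter_eq, image_empty]
    · rw [hpos hγ, hneg]
      exact hdY γ hγ
    · rw [hpos hγ', hneg]
      exact (hdY γ' hγ').symm
    · exact absurd rfl hne
  · intro x
    rw [← mem_Iio, ← hu]
    constructor
    · rintro (⟨y, hy, rfl⟩ | hx)
      · obtain ⟨γ, hγ, hy⟩ := (h.mem_iff y).1 hy
        exact ⟨γ, hγ.trans (Order.lt_succ ζ), by rw [hpos hγ]; exact mem_image_of_mem f hy⟩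
      · exact ⟨ζ, Order.lt_succ ζ, by rwa [hneg]⟩
    · rintro ⟨γ, hγ, hx⟩
      obtain hγ | rfl := hlt hγ
      · rw [hpos hγ] at hx
        exact .inl (image_mono (h.subset hγ) hx)
      · rw [hneg] at hx
        exact .inr hx
  · intro γ hγ
    obtain hγ | rfl := hlt hγ
    · simp only [hpos hγ]
      exact (h.hasOrderType γ hγ).image hf (h.subset hγ)
    · simpa only [hneg] using hY
  · intro ε hε
    obtain hε | rfl := hlt hε
    · refine ((h.crossings ε hε).insert ζ).subset ?_
      rintro γ ⟨hγ, hεγ, b, hb, a, ha, hba⟩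
      obtain hγ | rfl := hlt hγ
      · rw [hpos hγ] at hb
        rw [hpos hε] at ha
        obtain ⟨b, hb, rfl⟩ := hb
        obtain ⟨a, ha, rfl⟩ := ha
        exact .inr ⟨hγ, hεγ, b, hb, a, ha,
          (hf.lt_iff_lt (h.subset hγ hb) (h.subset hε ha)).1 hba⟩
      · exact .inl rfl
    · convert finite_empty
      refine eq_empty_of_forall_notMem fun γ hγ => ?_
      exact (Order.lt_add_one_iff.1 hγ.1).not_gt hγ.2.1
  -- Nonconvex pieces can only be the old ones, those containing a cut, and the new piece `Y`
  -- itself.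
  · have hfin : (⋃ c ∈ C, {ε | ε < ζ ∧ c ∈ A ε}).Finite := by
      refine hC.biUnion fun c _ => Set.Subsingleton.finite ?_
      rintro ε ⟨hε, hc⟩ ε' ⟨hε', hc'⟩
      by_contra hne
      exact disjoint_left.1 (h.disjoint ε hε ε' hε' hne) hc hc'
    refine ((h.convex.union hfin).insert ζ).subset ?_
    rintro ε ⟨hε, hconv⟩
    obtain hε | rfl := hlt hε
    · refine .inr ?_
      by_contra hcon
      simp only [mem_union, mem_iUnion, mem_ofPred_eq, not_or, not_and, not_not, not_exists]
        at hcon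
      obtain ⟨hA, hcon⟩ := hcon
      have hA := hA hε
      refine hconv ?_
      rw [hpos hε]
      refine ⟨?_⟩
      rintro _ ⟨x, hx, rfl⟩ _ ⟨x', hx', rfl⟩ w ⟨hxw, hwx'⟩
      have hxβ := h.subset hε hx
      have hxβ' := h.subset hε hx'
      have hw : w ∈ f '' Iio β ∪ Y := by
        rw [hu]
        have : f x' ∈ Iio (natSum β (α ζ)) := hu ▸ .inl (mem_image_of_mem f hxβ')
        exact hwx'.trans_lt this
      rcases hw with ⟨y, hy, rfl⟩ | hw
      · exact mem_image_of_mem f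
          (hA.out hx hx' ⟨(hf.le_iff_le hxβ hy).1 hxw, (hf.le_iff_le hy hxβ').1 hwx'⟩)
      -- A point of `Y` between two points of the image forces a cut `c` between their preimages,
      -- which convexity puts in `A ε`.
      · have hne : ∀ y ∈ A ε, f y ≠ w := fun y hy e =>
          disjoint_left.1 (hdY ε hε) (e ▸ mem_image_of_mem f hy) hw
        obtain ⟨c, hc, h₁, h₂⟩ := hcut x hxβ x' hxβ' w hw (hxw.lt_of_ne (hne x hx))
          (hwx'.lt_of_ne (hne x' hx').symm)
        exact absurd (hA.out hx hx' ⟨h₁.le, h₂⟩) (hcon c hc hε)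
    · exact .inl rfl

end IsTameRealization

/-- The realizations at different stages need not be compatible: the limit step uses the one at a
single `δ` and discards the rest. -/
theorem exists_isTameRealization (G : Set Ordinal.{u}) (α : Ordinal.{u} → Ordinal.{u})
    (ζ : Ordinal.{u}) : ∃ A, IsTameRealization ζ (partialNatSum G α ζ) α A := by
  have happend : ∀ δ ζ, δ ≤ ζ → (∃ A, IsTameRealization δ (partialNatSum G α δ) α A) →
      ∃ A, IsTameRealization ζ (partialNatSum G α δ + tailSum α δ ζ) α A := by
    rintro δ ζ hδ ⟨A, hA⟩
    refine ⟨_, IsTameRealization.append (T := fun γ => partialNatSum G α δ + tailSum α δ γ) hδ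
      (A := A) ?_ ?_ ?_ ?_⟩
    · simpa only [tailSum_self, add_zero] using hA
    · intro γ γ' hle
      dsimp only
      gcongr
      exact tailSum_mono α _ hle
    · intro γ h₁ _
      simp only [tailSum_add_one α h₁, add_assoc]
    · intro γ _ hl hδγ x hx
      obtain hx | ⟨y, hy, rfl⟩ := lt_or_exists_add hx
      · exact ⟨δ, hδγ, hx.trans_le le_self_add⟩
      · obtain ⟨γ', h, hy⟩ := lt_tailSum_limit α hl hy
        exact ⟨γ', h, by gcongr⟩
  induction ζ using limitRecOn with
  | zero =>
    rw [partialNatSum_zero]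
    exact ⟨fun _ => ∅, by constructor <;> simp⟩
  | add_one ζ ih =>
    by_cases h : ζ ∈ G
    · rw [partialNatSum_add_one_of_mem α h]
      obtain ⟨A, hA⟩ := ih
      exact hA.exists_natSum
    · rw [partialNatSum_add_one_of_notMem α h, ← tailSum_self_add_one α ζ]
      exact happend ζ (ζ + 1) le_self_add ih
  | limit ζ hζ ih =>
    obtain ⟨δ, hδ, h⟩ := exists_partialNatSum_eq_add_tailSum G α hζ
    rw [h δ le_rfl hδ]
    exact happend δ ζ hδ.le (ih δ hδ)

end MixedSums

/-- The partial natural sum `β` of a sequence `(α γ)` with `γ < ζ` relative to `G ⊆ ζ` is a mixed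
sum of that sequence, and it has a realization `(A γ)` in which, for each `ε < ζ`, only finitely
many `γ > ε` are such that some element of `A γ` lies below some element of `A ε`, and in which
all but finitely many pieces are convex. -/
theorem theorem4p2 (ζ : Ordinal.{u}) (α : Ordinal.{u} → Ordinal.{u}) (G : Set Ordinal.{u})
    (hG : G ⊆ Set.Iio ζ) :
    MixedSums.IsMixedSum (MixedSums.partialNatSum G α ζ) (fun γ : Set.Iio ζ => α γ) ∧
    ∃ A : Set.Iio ζ → Set Ordinal.{u},
      MixedSums.IsRealization (MixedSums.partialNatSum G α ζ) (fun γ : Set.Iio ζ => α γ) A ∧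
      (∀ ε : Set.Iio ζ,
        {γ : Set.Iio ζ | ε < γ ∧ ∃ b ∈ A γ, ∃ a ∈ A ε, b < a}.Finite) ∧
      {ε : Set.Iio ζ |
        ¬ MixedSums.IsConvexPiece (MixedSums.partialNatSum G α ζ) (A ε)}.Finite := by
  obtain ⟨A, hA⟩ := MixedSums.exists_isTameRealization G α ζ
  refine ⟨⟨_, hA.isRealization⟩, fun γ => A γ, hA.isRealization, fun ε => ?_, ?_⟩
  · refine Set.Finite.of_finite_image (f := Subtype.val) ((hA.crossings ε ε.2).subset ?_)
      Subtype.val_injective.injOn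
    rintro _ ⟨γ, ⟨h, hb⟩, rfl⟩
    exact ⟨γ.2, h, hb⟩
  · refine Set.Finite.of_finite_image (f := Subtype.val) (hA.convex.subset ?_)
      Subtype.val_injective.injOn
    rintro _ ⟨ε, h, rfl⟩
    refine ⟨ε.2, fun hc => h fun a ha a' ha' _ x hx => ?_⟩
    exact hc.out ha ha' ⟨hx.2.1.le, hx.2.2.le⟩
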